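/- For pairwise distinct points $w,x,y,z\in\mathbb{R}^2$ (probe positions on a two-dimensional sheet with uniform isotropic sheet resistance $\rho>0$), the four-probe resistance with current probes $w$ ($I^+$), $z$ ($I^-$) and voltage probes $x$ ($V^+$), $y$ ($V^-$) is \[ R^{wx}_{yz}(\rho)=\frac{\rho}{2\pi}\ln\!\left(\frac{\|x-z\|\,\|w-y\|}{\|w-x\|\,\|y-z\|}\right). \] Let $a,b,c\in\mathbb{R}^2$ be non-collinear (the known positions of three reference probes), and let $r_1,\dots,r_5\in\mathbb{R}$ be given (the measured values). Call $(\rho,d,e)$, with $\rho>0$ and $d,e\in\mathbb{R}^2$ such that $a,b,c,d,e$ are pairwise distinct, a candidate if \[ R^{da}_{bc}(\rho)=r_1,\quad R^{da}_{cb}(\rho)=r_2,\quad R^{ea}_{bc}(\rho)=r_3,\quad R^{ea}_{cb}(\rho)=r_4,\quad R^{bd}_{ce}(\rho)=r_5. \] Then only finitely many values $\rho$, and only finitely many pairs of positions $(d,e)$, occur in candidates $(\rho,d,e)$. Moreover, for each $\rho$ there are at most two pairs $(d,e)$ such that $(\rho,d,e)$ is a candidate. -/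

import Mathlib

/-- The plane of the two-dimensional sheet, with the Euclidean distance. -/
abbrev Plane : Type := EuclideanSpace ℝ (Fin 2)

/-- The four-probe resistance on an infinite uniform isotropic sheet with sheet resistance `ρ`:
current enters at `a` and leaves at `d`, and the voltage drop is taken from `b` to `c`.
It is meaningful for pairwise distinct probes. -/
noncomputable def resistance (ρ : ℝ) (a b c d : Plane) : ℝ :=
  ρ / (2 * Real.pi) * Real.log ((dist b d * dist a c) / (dist a b * dist c d))

/-- The sheet resistance `ρ` and the positions `d`, `e` of the unknown probes reproduce the five
measured values, the reference probes being at `a`, `b`, `c`: the sheet resistance is positive,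
each unknown probe sits at a point of the plane that no other probe occupies, and each of the
five resistances has its measured value. -/
structure Reproduces (a b c : Plane) (Rdabc Rdacb Reabc Reacb Rbdce : ℝ)
    (ρ : ℝ) (d e : Plane) : Prop where
  rho_pos : 0 < ρ
  d_ne_a : d ≠ a
  d_ne_b : d ≠ b
  d_ne_c : d ≠ c
  e_ne_a : e ≠ a
  e_ne_b : e ≠ b
  e_ne_c : e ≠ c
  d_ne_e : d ≠ e
  res_dabc : resistance ρ d a b c = Rdabc
  res_dacb : resistance ρ d a c b = Rdacb
  res_eabc : resistance ρ e a b c = Reabc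
  res_eacb : resistance ρ e a c b = Reacb
  res_bdce : resistance ρ b d c e = Rbdce

/-! Invert at `a` and put `t = 2π / ρ`. The four readings that use probe `a` fix the distances from
the images D, E of the unknown probes to the images B, C, each as |BC| times an exponential in `t`.
The fifth reading is a cross-ratio, which inversion preserves, so it fixes |DE| likewise
(`Reproduces.dist_inversion`). Four points of a plane have vanishing Gram determinant, and here that
is an exponential sum in `t`. At `t = 0` all six distances would be equal, as in a regular
tetrahedron, so the sum is not identically zero and has finitely many zeros
(`finite_zeros_probeGramDet`). For fixed `ρ`, the distances determine (D, E) up to reflection in the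
line BC (`encard_pairs_with_dist_le_two`). -/

open EuclideanGeometry

/-! ### Zeros of exponential sums -/

/-- A differentiable function with infinitely many zeros has a derivative with infinitely many
zeros, by Rolle's theorem. -/
theorem infinite_zeros_derivative {f f' : ℝ → ℝ} (hf : ∀ t, HasDerivAt f (f' t) t)
    (h : {t | f t = 0}.Infinite) : {t | f' t = 0}.Infinite := by
  intro hfin
  obtain ⟨s, hs, hcard⟩ := h.exists_subset_card_eq (hfin.toFinset.card + 2)
  have hle : s.card ≤ hfin.toFinset.card + 1 := by
    refine Finset.card_le_of_interleaved fun x hx y hy hxy _ => ?_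
    have hx0 : f x = 0 := hs hx
    have hy0 : f y = 0 := hs hy
    obtain ⟨z, hz, hz0⟩ := exists_hasDerivAt_eq_zero hxy
      (fun t _ => (hf t).continuousAt.continuousWithinAt) (hx0.trans hy0.symm)
      (fun t _ => hf t)
    exact ⟨z, by simpa using hz0, hz.1, hz.2⟩
  omega

/-- An exponential sum with infinitely many real zeros vanishes identically. -/
theorem exp_sum_eq_zero_of_infinite_zeros {ι : Type*} (s : Finset ι) (c μ : ι → ℝ)
    (h : {t : ℝ | ∑ i ∈ s, c i * Real.exp (μ i * t) = 0}.Infinite) (t : ℝ) :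
    ∑ i ∈ s, c i * Real.exp (μ i * t) = 0 := by
  classical
  induction s using Finset.induction_on generalizing c μ t with
  | empty => simp
  | insert j s hj ih =>
    -- Dividing by one exponential turns its term into a constant, which differentiation kills; the
    -- induction hypothesis then applies to the derivative.
    set g : ℝ → ℝ := fun t => c j + ∑ i ∈ s, c i * Real.exp ((μ i - μ j) * t) with hg
    have hfg : ∀ t, ∑ i ∈ insert j s, c i * Real.exp (μ i * t) = Real.exp (μ j * t) * g t := by
      intro t
      rw [Finset.sum_insert hj, hg, mul_add, Finset.mul_sum]
      congr 1
      · ring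
      · refine Finset.sum_congr rfl fun i _ => ?_
        rw [mul_left_comm, ← Real.exp_add]
        congr 2
        ring
    have hg' : ∀ t, HasDerivAt g
        (∑ i ∈ s, c i * (μ i - μ j) * Real.exp ((μ i - μ j) * t)) t := by
      intro t
      refine HasDerivAt.const_add _ (HasDerivAt.fun_sum fun i _ => ?_)
      have := (((hasDerivAt_id t).const_mul (μ i - μ j)).exp).const_mul (c i)
      refine this.congr_deriv ?_
      simp only [id]
      ring
    have hzeros : {t | g t = 0}.Infinite := by
      convert h using 3 with t
      rw [hfg]
      simp [Real.exp_ne_zero]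
    have hconst := is_const_of_deriv_eq_zero (fun t => (hg' t).differentiableAt) fun t =>
      (hg' t).deriv.trans (ih _ _ (infinite_zeros_derivative hg' hzeros) t)
    obtain ⟨t₀, ht₀⟩ := hzeros.nonempty
    rw [hfg, hconst t t₀, show g t₀ = 0 from ht₀, mul_zero]

/-- The algebra of real functions generated by the exponentials `t ↦ exp (l * t)`. -/
noncomputable def expAlgebra : Subalgebra ℝ (ℝ → ℝ) :=
  Algebra.adjoin ℝ (Set.range fun l t : ℝ => Real.exp (l * t))

theorem exp_mem_expAlgebra (l : ℝ) : (fun t : ℝ => Real.exp (l * t)) ∈ expAlgebra :=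
  Algebra.subset_adjoin ⟨l, rfl⟩

/-- The exponentials are closed under multiplication, so the algebra they generate is just their
linear span. -/
theorem exists_exp_sum_of_mem_expAlgebra {f : ℝ → ℝ} (hf : f ∈ expAlgebra) :
    ∃ c : ℝ →₀ ℝ, ∀ t, f t = ∑ l ∈ c.support, c l * Real.exp (l * t) := by
  let e : Multiplicative ℝ →* (ℝ → ℝ) :=
    { toFun := fun l t => Real.exp (l.toAdd * t)
      map_one' := by ext; simp
      map_mul' := fun a b => by ext; simp [add_mul, Real.exp_add] }
  have hspan : f ∈ Submodule.span ℝ (Set.range fun l t : ℝ => Real.exp (l * t)) := by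
    have hrange : (Set.range fun l t : ℝ => Real.exp (l * t)) = (MonoidHom.mrange e : Set _) := rfl
    have hmem : f ∈ Subalgebra.toSubmodule expAlgebra := hf
    rwa [expAlgebra, Algebra.adjoin_eq_span, hrange, Submonoid.closure_eq] at hmem
  obtain ⟨c, rfl⟩ := Finsupp.mem_span_range_iff_exists_finsupp.1 hspan
  exact ⟨c, fun t => by simp [Finsupp.sum, Finset.sum_apply]⟩

/-- A function in the exponential algebra that is nonzero somewhere has finitely many zeros. -/
theorem finite_zeros_of_mem_expAlgebra {f : ℝ → ℝ} (hf : f ∈ expAlgebra) {t₀ : ℝ}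
    (h : f t₀ ≠ 0) : {t | f t = 0}.Finite := by
  obtain ⟨c, hc⟩ := exists_exp_sum_of_mem_expAlgebra hf
  by_contra hinf
  refine h ?_
  simp only [hc] at hinf ⊢
  exact exp_sum_eq_zero_of_infinite_zeros c.support c id hinf t₀

/-! ### Four points in the plane -/

/-- Eight times the Gram determinant of the edge vectors at the first of four points, in terms of
the squared distances, listed as 12, 13, 23, 14, 24, 34. -/
def gramDet {R : Type*} [CommRing R] (x p q u v w : R) : R :=
  8 * x * p * u + 2 * (x + p - q) * (x + u - v) * (p + u - w) - 2 * x * (p + u - w) ^ 2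
    - 2 * p * (x + u - v) ^ 2 - 2 * u * (x + p - q) ^ 2

theorem Plane.dist_sq (x y : Plane) : dist x y ^ 2 = (x 0 - y 0) ^ 2 + (x 1 - y 1) ^ 2 := by
  rw [EuclideanSpace.dist_eq, Real.sq_sqrt (by positivity)]
  simp [Fin.sum_univ_two, Real.dist_eq, sq_abs]

/-- Three vectors in a plane are linearly dependent. -/
theorem gramDet_dist_sq (B C D E : Plane) :
    gramDet (dist B C ^ 2) (dist D B ^ 2) (dist D C ^ 2) (dist E B ^ 2) (dist E C ^ 2)
      (dist D E ^ 2) = 0 := by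
  simp only [Plane.dist_sq, gramDet]
  ring

/-- Twice the signed area of the triangle `B C X`. -/
noncomputable def signedArea (B C X : Plane) : ℝ :=
  (C 0 - B 0) * (X 1 - B 1) - (C 1 - B 1) * (X 0 - B 0)

/-- Lagrange's identity (u × v)(u × w) = |u|²(v · w) − (u · v)(u · w), with dot products expressed
by the law of cosines. Hence distances determine products of signed areas. -/
theorem signedArea_mul (B C D E : Plane) :
    4 * (signedArea B C D * signedArea B C E) =
      2 * dist B C ^ 2 * (dist D B ^ 2 + dist E B ^ 2 - dist D E ^ 2)
      - (dist B C ^ 2 + dist D B ^ 2 - dist D C ^ 2)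
        * (dist B C ^ 2 + dist E B ^ 2 - dist E C ^ 2) := by
  simp only [Plane.dist_sq, signedArea]
  ring

/-- Distances to two distinct points and the signed area determine a point. -/
theorem eq_of_dist_eq_of_signedArea_eq {B C X Y : Plane} (hBC : B ≠ C)
    (hB : dist X B = dist Y B) (hC : dist X C = dist Y C)
    (hs : signedArea B C X = signedArea B C Y) : X = Y := by
  have hL : dist B C ^ 2 ≠ 0 := pow_ne_zero _ (dist_ne_zero.2 hBC)
  have hB2 := congrArg (· ^ 2) hB
  have hC2 := congrArg (· ^ 2) hC
  simp only [Plane.dist_sq, signedArea] at hL hB2 hC2 hs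
  -- The distance equations control the component of X − Y along BC, the signed area the normal one.
  have h0 : X 0 = Y 0 := mul_left_cancel₀ hL (by
    linear_combination (B 1 - C 1) * hs + (B 0 - C 0) * (hC2 - hB2) / 2)
  have h1 : X 1 = Y 1 := mul_left_cancel₀ hL (by
    linear_combination -(B 0 - C 0) * hs + (B 1 - C 1) * (hC2 - hB2) / 2)
  ext i
  fin_cases i
  · exact h0
  · exact h1

/-- Two pairs of reals with equal squares and equal product agree up to a common sign. -/
theorem eq_or_eq_neg_of_sq_eq_of_mul_eq {s k s' k' : ℝ} (hs : s * s = s' * s')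
    (hk : k * k = k' * k') (hsk : s * k = s' * k') :
    s' = s ∧ k' = k ∨ s' = -s ∧ k' = -k := by
  rcases mul_self_eq_mul_self_iff.1 hs.symm with rfl | rfl <;>
    rcases mul_self_eq_mul_self_iff.1 hk.symm with rfl | rfl
  · simp
  · have : s' * k = 0 := by linarith
    rcases mul_eq_zero.1 this with rfl | rfl <;> simp
  · have : s * k' = 0 := by linarith
    rcases mul_eq_zero.1 this with rfl | rfl <;> simp
  · simp

/-- Pairs of points with prescribed distances to two distinct points and to each other take at
most two values. -/
theorem encard_pairs_with_dist_le_two {B C : Plane} (hBC : B ≠ C) (p q u v w : ℝ) :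
    {P : Plane × Plane | dist P.1 B = p ∧ dist P.1 C = q ∧ dist P.2 B = u ∧ dist P.2 C = v ∧
      dist P.1 P.2 = w}.encard ≤ 2 := by
  set S := {P : Plane × Plane | dist P.1 B = p ∧ dist P.1 C = q ∧ dist P.2 B = u ∧
    dist P.2 C = v ∧ dist P.1 P.2 = w} with hS
  have key : ∀ P ∈ S, ∀ Q ∈ S,
      signedArea B C Q.1 = signedArea B C P.1 ∧ signedArea B C Q.2 = signedArea B C P.2 ∨
      signedArea B C Q.1 = -signedArea B C P.1 ∧ signedArea B C Q.2 = -signedArea B C P.2 := by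
    rintro ⟨D, E⟩ ⟨h1, h2, h3, h4, h5⟩ ⟨D', E'⟩ ⟨h1', h2', h3', h4', h5'⟩
    dsimp only at *
    have m1 := signedArea_mul B C D D
    have m2 := signedArea_mul B C E E
    have m3 := signedArea_mul B C D E
    have m1' := signedArea_mul B C D' D'
    have m2' := signedArea_mul B C E' E'
    have m3' := signedArea_mul B C D' E'
    simp only [dist_self, h1, h2, h3, h4, h5, h1', h2', h3', h4', h5'] at m1 m2 m3 m1' m2' m3'
    exact eq_or_eq_neg_of_sq_eq_of_mul_eq (by linarith) (by linarith) (by linarith)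
  have ext_area : ∀ P ∈ S, ∀ Q ∈ S, signedArea B C Q.1 = signedArea B C P.1 →
      signedArea B C Q.2 = signedArea B C P.2 → Q = P := by
    rintro ⟨D, E⟩ ⟨h1, h2, h3, h4, -⟩ ⟨D', E'⟩ ⟨h1', h2', h3', h4', -⟩ hD hE
    exact Prod.ext
      (eq_of_dist_eq_of_signedArea_eq hBC (h1'.trans h1.symm) (h2'.trans h2.symm) hD)
      (eq_of_dist_eq_of_signedArea_eq hBC (h3'.trans h3.symm) (h4'.trans h4.symm) hE)
  by_cases hsub : S.Subsingleton
  · exact (Set.encard_le_one_iff_subsingleton.2 hsub).trans (by norm_num)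
  · obtain ⟨P, hP, Q, hQ, hne⟩ := Set.not_subsingleton_iff.1 hsub
    refine (Set.encard_le_encard (t := {P, Q}) fun T hT => ?_).trans
      (Set.encard_pair hne).le
    -- Since P ≠ Q, the areas of Q are those of P negated, so T matches either P or Q.
    rcases key P hP T hT with ⟨h1, h2⟩ | ⟨h1, h2⟩
    · exact Or.inl (ext_area P hP T hT h1 h2)
    · rcases key P hP Q hQ with ⟨h1', h2'⟩ | ⟨h1', h2'⟩
      · exact absurd (ext_area P hP Q hQ h1' h2').symm hne
      · exact Or.inr (ext_area Q hQ T hT (h1.trans h1'.symm) (h2.trans h2'.symm))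

/-! ### Resistances and inversion at a reference probe -/

theorem ratio_eq_exp_of_resistance_eq {ρ r : ℝ} (hρ : 0 < ρ) {w x y z : Plane}
    (hxz : x ≠ z) (hwy : w ≠ y) (hwx : w ≠ x) (hyz : y ≠ z) (h : resistance ρ w x y z = r) :
    dist x z * dist w y = dist w x * dist y z * Real.exp (r * (2 * Real.pi / ρ)) := by
  have h1 := dist_pos.2 hxz
  have h2 := dist_pos.2 hwy
  have h3 := dist_pos.2 hwx
  have h4 := dist_pos.2 hyz
  have hlog : r * (2 * Real.pi / ρ) =
      Real.log ((dist x z * dist w y) / (dist w x * dist y z)) := by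
    have := Real.pi_ne_zero
    rw [← h, resistance]
    field_simp
  rw [hlog, Real.exp_log (by positivity)]
  field_simp

/-- For an unknown probe at `d`, the two resistances measured against the reference probes fix the
distances of its image under inversion at `a` to the images of `b` and `c`. -/
theorem dist_inversion_of_resistance_eq {ρ r : ℝ} (hρ : 0 < ρ) {a b c d : Plane}
    (hab : a ≠ b) (hac : a ≠ c) (hbc : b ≠ c) (hda : d ≠ a) (hdb : d ≠ b)
    (h : resistance ρ d a b c = r) :
    dist (inversion a 1 d) (inversion a 1 b) =
      dist (inversion a 1 b) (inversion a 1 c) * Real.exp (r * (2 * Real.pi / ρ)) := by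
  have key := ratio_eq_exp_of_resistance_eq hρ hac hdb hda hbc h
  rw [dist_inversion_inversion hda hab.symm, dist_inversion_inversion hab.symm hac.symm]
  have h1 := dist_pos.2 hda
  have h2 := dist_pos.2 hab.symm
  have h3 := dist_pos.2 hac.symm
  rw [dist_comm a c] at key
  generalize Real.exp (r * (2 * Real.pi / ρ)) = k at key ⊢
  field_simp
  linarith

/-- The distances between the images under inversion at `a` of the probes of a candidate. -/
theorem Reproduces.dist_inversion {a b c : Plane} (hab : a ≠ b) (hac : a ≠ c) (hbc : b ≠ c)
    {r₁ r₂ r₃ r₄ r₅ ρ : ℝ} {d e : Plane} (h : Reproduces a b c r₁ r₂ r₃ r₄ r₅ ρ d e) :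
    let L := dist (inversion a 1 b) (inversion a 1 c)
    let t := 2 * Real.pi / ρ
    dist (inversion a 1 d) (inversion a 1 b) = L * Real.exp (r₁ * t) ∧
    dist (inversion a 1 d) (inversion a 1 c) = L * Real.exp (r₂ * t) ∧
    dist (inversion a 1 e) (inversion a 1 b) = L * Real.exp (r₃ * t) ∧
    dist (inversion a 1 e) (inversion a 1 c) = L * Real.exp (r₄ * t) ∧
    dist (inversion a 1 d) (inversion a 1 e) = L * Real.exp ((r₁ + r₄ + r₅) * t) := by
  intro L t
  have hL : L = dist (inversion a 1 c) (inversion a 1 b) := dist_comm _ _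
  have h1 := dist_inversion_of_resistance_eq h.rho_pos hab hac hbc h.d_ne_a h.d_ne_b h.res_dabc
  have h2 := dist_inversion_of_resistance_eq h.rho_pos hac hab hbc.symm h.d_ne_a h.d_ne_c
    h.res_dacb
  have h3 := dist_inversion_of_resistance_eq h.rho_pos hab hac hbc h.e_ne_a h.e_ne_b h.res_eabc
  have h4 := dist_inversion_of_resistance_eq h.rho_pos hac hab hbc.symm h.e_ne_a h.e_ne_c
    h.res_eacb
  rw [← hL] at h2 h4
  refine ⟨h1, h2, h3, h4, ?_⟩
  have h5 := ratio_eq_exp_of_resistance_eq h.rho_pos h.d_ne_e hbc h.d_ne_b.symm h.e_ne_c.symm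
    h.res_bdce
  have hLpos : 0 < L := dist_pos.2 fun hinv => hbc (inversion_injective a one_ne_zero hinv)
  have hda := dist_pos.2 h.d_ne_a
  have hea := dist_pos.2 h.e_ne_a
  have hba := dist_pos.2 hab.symm
  have hca := dist_pos.2 hac.symm
  have hcross : dist (inversion a 1 d) (inversion a 1 e) * L =
      dist (inversion a 1 d) (inversion a 1 b) * dist (inversion a 1 e) (inversion a 1 c)
        * Real.exp (r₅ * t) := by
    simp only [L]
    rw [dist_inversion_inversion h.d_ne_a h.e_ne_a, dist_inversion_inversion h.d_ne_a hab.symm,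
      dist_inversion_inversion h.e_ne_a hac.symm, dist_inversion_inversion hab.symm hac.symm]
    rw [dist_comm b d, dist_comm c e] at h5
    field_simp
    linarith
  rw [h1, h4] at hcross
  refine mul_right_cancel₀ hLpos.ne' (hcross.trans ?_)
  rw [add_mul, add_mul, Real.exp_add, Real.exp_add]
  ring

/-- The Gram determinant of the inverted probe configuration, normalized to `dist B C = 1`, as a
function of `t = 2π / ρ`. -/
noncomputable def probeGramDet (r₁ r₂ r₃ r₄ r₅ : ℝ) : ℝ → ℝ :=
  gramDet 1 ((fun t => Real.exp (r₁ * t)) ^ 2) ((fun t => Real.exp (r₂ * t)) ^ 2)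
    ((fun t => Real.exp (r₃ * t)) ^ 2) ((fun t => Real.exp (r₄ * t)) ^ 2)
    ((fun t => Real.exp ((r₁ + r₄ + r₅) * t)) ^ 2)

/-- A polynomial expression can be evaluated inside the subalgebra itself. -/
theorem gramDet_mem {R A : Type*} [CommRing R] [CommRing A] [Algebra R A] (S : Subalgebra R A)
    {x p q u v w : A} (hx : x ∈ S) (hp : p ∈ S) (hq : q ∈ S) (hu : u ∈ S) (hv : v ∈ S)
    (hw : w ∈ S) : gramDet x p q u v w ∈ S :=
  (gramDet (⟨x, hx⟩ : S) ⟨p, hp⟩ ⟨q, hq⟩ ⟨u, hu⟩ ⟨v, hv⟩ ⟨w, hw⟩).2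

theorem finite_zeros_probeGramDet (r₁ r₂ r₃ r₄ r₅ : ℝ) :
    {t | probeGramDet r₁ r₂ r₃ r₄ r₅ t = 0}.Finite := by
  have hmem : ∀ l, (fun t : ℝ => Real.exp (l * t)) ^ 2 ∈ expAlgebra := fun l =>
    pow_mem (exp_mem_expAlgebra l) 2
  refine finite_zeros_of_mem_expAlgebra (t₀ := 0)
    (gramDet_mem _ (one_mem _) (hmem _) (hmem _) (hmem _) (hmem _) (hmem _)) ?_
  norm_num [probeGramDet, gramDet]

theorem Reproduces.probeGramDet_eq_zero {a b c : Plane} (hab : a ≠ b) (hac : a ≠ c) (hbc : b ≠ c)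
    {r₁ r₂ r₃ r₄ r₅ ρ : ℝ} {d e : Plane} (h : Reproduces a b c r₁ r₂ r₃ r₄ r₅ ρ d e) :
    probeGramDet r₁ r₂ r₃ r₄ r₅ (2 * Real.pi / ρ) = 0 := by
  obtain ⟨h1, h2, h3, h4, h5⟩ := h.dist_inversion hab hac hbc
  have hL : dist (inversion a 1 b) (inversion a 1 c) ≠ 0 :=
    dist_ne_zero.2 fun hinv => hbc (inversion_injective a one_ne_zero hinv)
  have hg := gramDet_dist_sq (inversion a 1 b) (inversion a 1 c) (inversion a 1 d)
    (inversion a 1 e)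
  rw [h1, h2, h3, h4, h5] at hg
  -- `gramDet` is homogeneous of degree 3 in squared distances, so rescaling by |BC| contributes a
  -- sixth power.
  refine mul_left_cancel₀ (pow_ne_zero 6 hL) ?_
  rw [mul_zero, ← hg]
  simp only [probeGramDet, gramDet, Pi.add_apply, Pi.sub_apply, Pi.mul_apply, Pi.pow_apply,
    Pi.ofNat_apply]
  ring

theorem lemma3 (a b c : Plane) (habc : ¬ Collinear ℝ ({a, b, c} : Set Plane))
    (Rdabc Rdacb Reabc Reacb Rbdce : ℝ) :
    {ρ : ℝ | ∃ d e : Plane, Reproduces a b c Rdabc Rdacb Reabc Reacb Rbdce ρ d e}.Finite ∧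
    {p : Plane × Plane |
      ∃ ρ : ℝ, Reproduces a b c Rdabc Rdacb Reabc Reacb Rbdce ρ p.1 p.2}.Finite ∧
    ∀ ρ : ℝ, {p : Plane × Plane |
      Reproduces a b c Rdabc Rdacb Reabc Reacb Rbdce ρ p.1 p.2}.encard ≤ 2 := by
  have hab : a ≠ b := ne₁₂_of_not_collinear habc
  have hac : a ≠ c := ne₁₃_of_not_collinear habc
  have hbc : b ≠ c := ne₂₃_of_not_collinear habc
  have hinj : Function.Injective (inversion a 1 : Plane → Plane) :=
    inversion_injective a one_ne_zero
  have htwo : ∀ ρ : ℝ, {p : Plane × Plane |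
      Reproduces a b c Rdabc Rdacb Reabc Reacb Rbdce ρ p.1 p.2}.encard ≤ 2 := by
    intro ρ
    rw [← (hinj.prodMap hinj).encard_image]
    set L := dist (inversion a 1 b) (inversion a 1 c)
    set k : ℝ → ℝ := fun r => L * Real.exp (r * (2 * Real.pi / ρ))
    refine (Set.encard_le_encard ?_).trans
      (encard_pairs_with_dist_le_two (hinj.ne hbc) (k Rdabc) (k Rdacb) (k Reabc) (k Reacb)
        (k (Rdabc + Reacb + Rbdce)))
    rintro _ ⟨⟨d, e⟩, h, rfl⟩
    exact Reproduces.dist_inversion hab hac hbc h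
  have hρ : {ρ : ℝ | ∃ d e : Plane,
      Reproduces a b c Rdabc Rdacb Reabc Reacb Rbdce ρ d e}.Finite := by
    -- Injectivity holds on all of ℝ because division by zero gives 0.
    have hinv : Function.Injective fun ρ : ℝ => 2 * Real.pi / ρ := fun x y hxy => by
      simpa [div_eq_mul_inv, Real.pi_ne_zero] using hxy
    refine ((finite_zeros_probeGramDet Rdabc Rdacb Reabc Reacb Rbdce).preimage
      hinv.injOn).subset ?_
    rintro ρ ⟨d, e, h⟩
    exact h.probeGramDet_eq_zero hab hac hbc
  refine ⟨hρ, ?_, htwo⟩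
  refine (hρ.biUnion fun ρ _ =>
    Set.finite_of_encard_le_coe (k := 2) (htwo ρ)).subset ?_
  rintro ⟨d, e⟩ ⟨ρ, h⟩
  exact Set.mem_biUnion (show ρ ∈ {ρ : ℝ | ∃ d e : Plane, _} from ⟨d, e, h⟩) h
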